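/- Let $M$ be a smooth supermanifold of dimension $n|m$ (an ordinary manifold if $m=0$). Let $\Pi T^*M$ be its parity-shifted cotangent bundle. Local coordinates $x^a$ on $M$, of parity $\tilde a$, induce coordinates $x^a, x^*_a$ on $\Pi T^*M$, where $x^*_a$ has parity $\tilde a+1$ and $x^*_a=\frac{\partial x^{b'}}{\partial x^a}\,x^*_{b'}$ under a change of coordinates. All derivatives are left derivatives. A multivector field on $M$ is a smooth function $H(x,x^*)$ on $\Pi T^*M$. A multivector density (integral form) on $M$ is an object $\sigma=s(x,x^*)\,Dx$, given in each coordinate system by a smooth function $s$ on $\Pi T^*M$, with $s(x,x^*)=s'(x',x^{*\prime})\operatorname{Ber}\frac{\partial x'}{\partial x}$ under a change of coordinates. The divergence operator on multivector densities is $$\delta\sigma=\sum_a(-1)^{\tilde a}\,\frac{\partial^2 s}{\partial x^a\,\partial x^*_a}\,Dx .$$ Let $H$ be homogeneous of parity $\tilde H$. The infinitesimal canonical transformation of $\Pi T^*M$ generated by the Hamiltonian $H$ is $F^*f=f+\varepsilon\{H,f\}$, where $\varepsilon$ is a parameter of parity $\tilde H+1$ with $\varepsilon^2=0$ and $$\{H,f\}=\sum_a(-1)^{\tilde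 a}\Bigl((-1)^{\tilde a\tilde H}\frac{\partial H}{\partial x^*_a}\frac{\partial f}{\partial x^a}+(-1)^{(\tilde a+1)\tilde H}\frac{\partial H}{\partial x^a}\frac{\partial f}{\partial x^*_a}\Bigr)$$ is the canonical odd bracket. Writing it as $(x,x^*)\mapsto(y,y^*)$, let it act on multivector densities by $$F^*(s\,Dx)=s(y,y^*)\,\operatorname{Ber}\Bigl(\frac{\partial y}{\partial x}\Bigr)Dx ,$$ and define the Lie derivative $L_H$ by $F^*\sigma=\sigma+\varepsilon L_H\sigma$. The divergence $\delta$ and the Lie derivative $L_H$ are understood through these expressions in every local coordinate system of $M$. Then: 1. In every local coordinate system of $M$, $\bigl(\operatorname{Ber}\frac{\partial y}{\partial x}\bigr)^2=\operatorname{Ber}\frac{\partial(y,y^*)}{\partial(x,x^*)}$. That is, under the identification of multivector densities on $M$ with half-densities on $\Pi T^*M$, the action above is the action on half-densities. 2. On multivector densities on $M$, in every local coordinate system, $L_H$ is the (super)commutator of $\delta$ with multiplication by $H$: $$L_H\sigma=[\delta,H]\sigma=\delta(H\sigma)-(-1)^{\tilde H}H\,\delta\sigma .$$ -/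

import Mathlib

open scoped Manifold ContDiff TensorProduct
open TopologicalSpace CategoryTheory

universe u

noncomputable section

namespace SuperGeom

/-! ### Functions on superdomains -/

/-- Smooth real functions on an open subset of `ℝ^p`. -/
abbrev Smooth {p : Type} [Fintype p] (W : Opens (p → ℝ)) : Type :=
  ContMDiffMap 𝓘(ℝ, p → ℝ) 𝓘(ℝ, ℝ) W ℝ ∞

/-- The Grassmann algebra with one generator for each element of `q`. -/
abbrev Grassmann (q : Type) : Type := ExteriorAlgebra ℝ (q → ℝ)

/-- The algebra `C^∞(W) ⊗ Λ(q)` of functions on the superdomain with body `W ⊆ ℝ^p` and odd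
coordinates indexed by `q`. -/
abbrev SFun {p : Type} [Fintype p] (W : Opens (p → ℝ)) (q : Type) : Type :=
  Smooth W ⊗[ℝ] Grassmann q

namespace Smooth

variable {p : Type} [Fintype p]

lemma contDiffAt_extend {W : Opens (p → ℝ)} (f : Smooth W) (w : W) :
    ContDiffAt ℝ ∞ (Function.extend Subtype.val (f : W → ℝ) 0) (w : p → ℝ) := by
  rw [← contMDiffAt_iff_contDiffAt, ← contMDiffAt_subtype_iff (U := W) (x := w)]
  have : (fun x : W => Function.extend Subtype.val (f : W → ℝ) 0 (x : p → ℝ)) = f := by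
    funext x
    exact Subtype.val_injective.extend_apply _ _ x
  rw [this]
  exact f.contMDiff w

/-- A function that is smooth on `W`, as an element of `C^∞(W)`. -/
def ofContDiffAt (W : Opens (p → ℝ)) (g : (p → ℝ) → ℝ)
    (hg : ∀ w : W, ContDiffAt ℝ ∞ g (w : p → ℝ)) : Smooth W :=
  ⟨fun w => g w, fun w => by
    have := (contMDiffAt_subtype_iff (I := 𝓘(ℝ, p → ℝ)) (I' := 𝓘(ℝ, ℝ)) (n := ∞) (U := W)
      (f := g) (x := w)).2 (hg w).contMDiffAt
    exact this⟩

/-- Pull-back of functions along a map that is the restriction of a linear map of the ambient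
spaces. -/
def comap {p' : Type} [Fintype p'] {W : Opens (p → ℝ)} {W' : Opens (p' → ℝ)}
    (L : (p → ℝ) →L[ℝ] (p' → ℝ)) (h : ∀ x ∈ W, L x ∈ W') : Smooth W' →ₐ[ℝ] Smooth W where
  toFun f := ofContDiffAt W (fun x => Function.extend Subtype.val (f : W' → ℝ) 0 (L x))
    (fun w => ContDiffAt.comp (w : p → ℝ) (contDiffAt_extend f ⟨L w, h w w.2⟩)
      L.contDiff.contDiffAt)
  map_one' := by
    ext w; exact Subtype.val_injective.extend_apply _ _ (⟨L w, h w w.2⟩ : W')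
  map_mul' f g := by
    ext w
    have := fun k : Smooth W' =>
      Subtype.val_injective.extend_apply (k : W' → ℝ) 0 (⟨L w, h w w.2⟩ : W')
    exact (this _).trans (congrArg₂ (· * ·) (this f).symm (this g).symm)
  map_zero' := by
    ext w; exact Subtype.val_injective.extend_apply _ _ (⟨L w, h w w.2⟩ : W')
  map_add' f g := by
    ext w
    have := fun k : Smooth W' =>
      Subtype.val_injective.extend_apply (k : W' → ℝ) 0 (⟨L w, h w w.2⟩ : W')
    exact (this _).trans (congrArg₂ (· + ·) (this f).symm (this g).symm)
  commutes' r := by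
    ext w; exact Subtype.val_injective.extend_apply _ _ (⟨L w, h w w.2⟩ : W')

variable [DecidableEq p]

/-- The partial derivative `∂/∂x_i` on `C^∞(W)`. -/
def pd {W : Opens (p → ℝ)} (i : p) : Smooth W →ₗ[ℝ] Smooth W where
  toFun f := ofContDiffAt W
    (fun x => fderiv ℝ (Function.extend Subtype.val (f : W → ℝ) 0) x (Pi.single i 1))
    (fun w => ((contDiffAt_extend f w).fderiv_right (m := ∞) le_rfl).clm_apply contDiffAt_const)
  map_add' f g := by
    ext w
    have hd := fun h : Smooth W => (contDiffAt_extend h w).differentiableAt (by simp)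
    have he : Function.extend Subtype.val (fun x : W => f x + g x) (0 : (p → ℝ) → ℝ) =
        Function.extend Subtype.val (f : W → ℝ) 0 +
          Function.extend Subtype.val (g : W → ℝ) 0 := by
      have := Function.extend_add (Subtype.val : W → (p → ℝ)) (f : W → ℝ) (g : W → ℝ) 0 0
      rw [add_zero] at this
      exact this
    have := congrArg (fun k : (p → ℝ) → ℝ => fderiv ℝ k (w : p → ℝ) (Pi.single i 1)) he
    simp only [fderiv_add (hd f) (hd g)] at this
    exact this
  map_smul' r f := by
    ext w
    have hd := (contDiffAt_extend f w).differentiableAt (by simp)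
    have he : Function.extend Subtype.val (fun x : W => r * f x) (0 : (p → ℝ) → ℝ) =
        r • Function.extend Subtype.val (f : W → ℝ) 0 := by
      have := Function.extend_smul r (Subtype.val : W → (p → ℝ)) (f : W → ℝ) 0
      rw [smul_zero] at this
      exact this
    have := congrArg (fun k : (p → ℝ) → ℝ => fderiv ℝ k (w : p → ℝ) (Pi.single i 1)) he
    simp only [fderiv_const_smul hd] at this
    exact this

/-- The coordinate function `x_i` on `W`. -/
def coord (W : Opens (p → ℝ)) (i : p) : Smooth W :=
  ofContDiffAt W (fun x => x i) (fun _ => (contDiff_apply ℝ ℝ i).contDiffAt)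

end Smooth

/-- The sign `(-1)^r` for a parity `r`. -/
def sgn (r : ZMod 2) : ℝ := (-1) ^ r.val

/-- Parity of a coordinate: coordinates are indexed by `p ⊕ q`, those in `p` being even and those
in `q` odd. -/
def par {p q : Type} : p ⊕ q → ZMod 2 := Sum.elim (fun _ => 0) (fun _ => 1)

namespace SFun

variable {p q : Type} [Fintype p]

/-- The parity involution: identity on even functions, `-1` on odd functions. -/
def invol {W : Opens (p → ℝ)} : SFun W q →ₐ[ℝ] SFun W q :=
  Algebra.TensorProduct.map (AlgHom.id ℝ _) CliffordAlgebra.involute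

/-- `f` is homogeneous of parity `r`. -/
def HasParity {W : Opens (p → ℝ)} (r : ZMod 2) (f : SFun W q) : Prop :=
  invol f = sgn r • f

/-- The homomorphism `f ↦ (-1)^{r f̃} f`. -/
def signHom {W : Opens (p → ℝ)} (r : ZMod 2) : SFun W q →ₐ[ℝ] SFun W q :=
  if r = 0 then AlgHom.id ℝ _ else invol

/-- The left partial derivative along the coordinate `A`: for an even coordinate it acts on the
coefficients, for an odd one it is the odd left derivation of the Grassmann algebra. -/
def pd [DecidableEq p] {W : Opens (p → ℝ)} (A : p ⊕ q) : SFun W q →ₗ[ℝ] SFun W q :=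
  Sum.elim (fun i => TensorProduct.map (Smooth.pd i) LinearMap.id)
    (fun j => TensorProduct.map LinearMap.id
      (CliffordAlgebra.contractLeft (LinearMap.proj j : (q → ℝ) →ₗ[ℝ] ℝ))) A

/-- The coordinate functions of a superdomain. -/
def coord [DecidableEq q] (W : Opens (p → ℝ)) (A : p ⊕ q) : SFun W q :=
  Sum.elim (fun i => Smooth.coord W i ⊗ₜ[ℝ] (1 : Grassmann q))
    (fun j => (1 : Smooth W) ⊗ₜ[ℝ] ExteriorAlgebra.ι ℝ (Pi.single j (1 : ℝ))) A

/-- Restriction of functions to a smaller superdomain. -/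
def res {V W : Opens (p → ℝ)} (h : V ≤ W) : SFun W q →ₐ[ℝ] SFun V q :=
  Algebra.TensorProduct.map (Smooth.comap (ContinuousLinearMap.id ℝ _) h) (AlgHom.id ℝ _)

end SFun

/-! ### The Berezinian -/

/-- The determinant (Leibniz formula) of a square matrix whose entries commute with one another;
the product over the index set does not depend on the order chosen. -/
def detL {ι R : Type} [Fintype ι] [DecidableEq ι] [Ring R] (A : Matrix ι ι R) : R :=
  ∑ s : Equiv.Perm ι,
    (Equiv.Perm.sign s : ℤ) • ((Finset.univ.toList : List ι).map fun i => A (s i) i).prod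

/-- The Berezinian `det (J₀₀ - J₀₁ J₁₁⁻¹ J₁₀) / det J₁₁` of an invertible even supermatrix. -/
def ber {p q R : Type} [Fintype p] [Fintype q] [DecidableEq p] [DecidableEq q] [Ring R]
    (J : Matrix (p ⊕ q) (p ⊕ q) R) : R :=
  detL (J.toBlocks₁₁ - J.toBlocks₁₂ * Ring.inverse J.toBlocks₂₂ * J.toBlocks₂₁) *
    Ring.inverse (detL J.toBlocks₂₂)

/-! ### The infinitesimal parameter -/

/-- The multiples `ε g` of a parameter `ε` of parity `r`, `g` being a function. -/
def EpsPart {p : Type} [Fintype p] (_r : ZMod 2) (W : Opens (p → ℝ)) (q : Type) : Type := SFun W q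

section Eps

variable {p : Type} [Fintype p] (r : ZMod 2) (W : Opens (p → ℝ)) (q : Type)

instance : AddCommGroup (EpsPart r W q) := inferInstanceAs (AddCommGroup (SFun W q))

/-- `f · εg = ε ((-1)^{r f̃} f g)`. -/
instance : Module (SFun W q) (EpsPart r W q) :=
  Module.compHom (SFun W q) (SFun.signHom r : SFun W q →ₐ[ℝ] SFun W q).toRingHom

/-- `εg · f = ε (g f)`. -/
instance : Module (SFun W q)ᵐᵒᵖ (EpsPart r W q) :=
  inferInstanceAs (Module (SFun W q)ᵐᵒᵖ (SFun W q))

instance : SMulCommClass (SFun W q) (SFun W q)ᵐᵒᵖ (EpsPart r W q) where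
  smul_comm a b x := (mul_assoc (SFun.signHom r a : SFun W q) x b.unop).symm

/-- The superalgebra of functions `f + ε g` on a superdomain, with one additional parameter `ε`
of parity `r`, `ε² = 0`. -/
abbrev EpsFun : Type := TrivSqZeroExt (SFun W q) (EpsPart r W q)

variable {r W q}

/-- The function `f + ε g`. -/
def EpsFun.mk (f g : SFun W q) : EpsFun r W q := (f, g)

/-- The coefficient `g` of `f + ε g`. -/
def EpsFun.epsCoeff (F : EpsFun r W q) : SFun W q := F.2

/-- Left partial derivatives, `∂_A (f + ε g) = ∂_A f + (-1)^{Ã r} ε ∂_A g`. -/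
def EpsFun.pd [DecidableEq p] (A : p ⊕ q) (F : EpsFun r W q) : EpsFun r W q :=
  EpsFun.mk (SFun.pd A F.fst) (sgn (par A * r) • SFun.pd A F.epsCoeff)

end Eps

/-! ### Local geometry of `ΠT*M`

If `M` has coordinates `x^a`, `a : Fin n ⊕ Fin m`, then `ΠT*M` has the coordinates
`x^a` and `x*_a`; the even ones are indexed by `Fin n ⊕ Fin m` (the even `x^a` and the `x*_a`
conjugate to odd `x^a`), the odd ones by `Fin m ⊕ Fin n`. -/

/-- Index of a coordinate on `M`. -/
abbrev Idx (n m : ℕ) : Type := Fin n ⊕ Fin m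

/-- Index of a coordinate on `ΠT*M`. -/
abbrev CIdx (n m : ℕ) : Type := (Fin n ⊕ Fin m) ⊕ (Fin m ⊕ Fin n)

/-- `x^a` as a coordinate on `ΠT*M`. -/
def pos {n m : ℕ} : Idx n m → CIdx n m := Sum.map Sum.inl Sum.inl

/-- `x*_a` as a coordinate on `ΠT*M`; its parity is opposite to that of `x^a`. -/
def mom {n m : ℕ} : Idx n m → CIdx n m :=
  Sum.elim (fun i => Sum.inr (Sum.inr i)) (fun j => Sum.inl (Sum.inr j))

/-- The body `V × ℝ^m` of `ΠT*V`. -/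
def cot {n : ℕ} (m : ℕ) (V : Opens (Fin n → ℝ)) : Opens (Fin n ⊕ Fin m → ℝ) where
  carrier := {z | (fun i => z (Sum.inl i)) ∈ V}
  is_open' := V.isOpen.preimage (by fun_prop)

lemma cot_mono {n m : ℕ} {V W : Opens (Fin n → ℝ)} (h : V ≤ W) : cot m V ≤ cot m W :=
  fun _ hz => h hz

/-- Functions on `V ⊆ ℝ^{n|m}`. -/
abbrev BFun {n : ℕ} (m : ℕ) (V : Opens (Fin n → ℝ)) : Type := SFun V (Fin m)

/-- Functions `s(x,x*)` on `ΠT*V`. -/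
abbrev CFun {n : ℕ} (m : ℕ) (V : Opens (Fin n → ℝ)) : Type := SFun (cot m V) (Fin m ⊕ Fin n)

/-- Functions on `V` regarded as functions on `ΠT*V`. -/
def baseHom {n m : ℕ} (V : Opens (Fin n → ℝ)) : BFun m V →ₐ[ℝ] CFun m V :=
  Algebra.TensorProduct.map
    (Smooth.comap (ContinuousLinearMap.pi fun i => ContinuousLinearMap.proj (Sum.inl i))
      (fun _ h => h))
    (ExteriorAlgebra.map
      (LinearMap.pi (Sum.elim (fun j => LinearMap.proj j) (fun _ => 0)) :
        (Fin m → ℝ) →ₗ[ℝ] (Fin m ⊕ Fin n → ℝ)))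

section Local

variable {n m : ℕ} {V : Opens (Fin n → ℝ)}

/-- The divergence `∑_a (-1)^{ã} ∂²s/∂x^a∂x*_a` in coordinates. -/
def divLocal : CFun m V →ₗ[ℝ] CFun m V :=
  ∑ a : Idx n m, sgn (par a) • (SFun.pd (pos a) ∘ₗ SFun.pd (mom a))

/-- The canonical odd bracket `{H, f}` on `ΠT*V`, for `H` of parity `h`. -/
def oddBracket (h : ZMod 2) (H : CFun m V) (f : CFun m V) : CFun m V :=
  ∑ a : Idx n m, sgn (par a) •
    (sgn (par a * h) • (SFun.pd (mom a) H * SFun.pd (pos a) f) +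
      sgn ((par a + 1) * h) • (SFun.pd (pos a) H * SFun.pd (mom a) f))

/-- The infinitesimal canonical transformation of `ΠT*V` generated by a Hamiltonian `H` of parity
`h`, as a pull-back of functions: `F^* f = f + ε {H, f}`, with `ε` of parity `h + 1`. -/
def hamTransf (h : ZMod 2) (H : CFun m V) (f : CFun m V) :
    EpsFun (h + 1) (cot m V) (Fin m ⊕ Fin n) :=
  EpsFun.mk f (oddBracket h H f)

/-- The Jacobi matrix `∂(y,y*)/∂(x,x*)` of a transformation `F : (x,x*) ↦ (y,y*)`. -/
def jacobian {r : ZMod 2} (F : CFun m V → EpsFun r (cot m V) (Fin m ⊕ Fin n)) :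
    Matrix (CIdx n m) (CIdx n m) (EpsFun r (cot m V) (Fin m ⊕ Fin n)) :=
  fun A B => EpsFun.pd A (F (SFun.coord _ B))

/-- The block `∂y/∂x` of the Jacobi matrix of `F : (x,x*) ↦ (y,y*)`. -/
def jacobianPos {r : ZMod 2} (F : CFun m V → EpsFun r (cot m V) (Fin m ⊕ Fin n)) :
    Matrix (Idx n m) (Idx n m) (EpsFun r (cot m V) (Fin m ⊕ Fin n)) :=
  (jacobian F).submatrix pos pos

/-- The action of a canonical transformation on multivector densities:
`F^*(s Dx) = s(y(x,x*), y*(x,x*)) Ber(∂y/∂x) Dx`. -/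
def pullDensity {r : ZMod 2} (F : CFun m V → EpsFun r (cot m V) (Fin m ⊕ Fin n)) (s : CFun m V) :
    EpsFun r (cot m V) (Fin m ⊕ Fin n) :=
  F s * ber (jacobianPos F)

/-- The Lie derivative of a multivector density along the infinitesimal canonical transformation
generated by `H`: the coefficient of `ε` in `F^*(s Dx) = (s + ε L_H s) Dx`. -/
def lieLocal (h : ZMod 2) (H : CFun m V) (s : CFun m V) : CFun m V :=
  (pullDensity (hamTransf h H) s).epsCoeff

/-- `Φ` is the transformation `(x,x*) ↦ (x',x*')` of `ΠT*` induced by the coordinate change `φ`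
of the base (both as pull-backs of functions): it is even, covers `φ`, and
`x*_a = (∂x^{b'}/∂x^a) x*_{b'}`. -/
structure IsCotangentLift {V' : Opens (Fin n → ℝ)} (φ : BFun m V' →ₐ[ℝ] BFun m V)
    (Φ : CFun m V' →ₐ[ℝ] CFun m V) : Prop where
  even : ∀ f, Φ (SFun.invol f) = SFun.invol (Φ f)
  base : ∀ f, Φ (baseHom V' f) = baseHom V (φ f)
  fibre : ∀ a : Idx n m, SFun.coord (cot m V) (mom a) =
    ∑ b : Idx n m, baseHom V (SFun.pd a (φ (SFun.coord V' b))) * Φ (SFun.coord (cot m V') (mom b))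

end Local

/-! ### Supermanifolds -/

/-- Restriction of sections of a sheaf of algebras. -/
def sres {X : TopCat.{u}} (O : TopCat.Sheaf (AlgCat.{u} ℝ) X) {U U' : Opens X} (h : U ≤ U') :
    O.presheaf.obj (.op U') →ₐ[ℝ] O.presheaf.obj (.op U) :=
  (O.presheaf.map (homOfLE h).op).hom

/-- The open subset of the domain of a topological chart over the open subset `V` of its range. -/
def pre {X : TopCat.{u}} {n : ℕ} (e : OpenPartialHomeomorph X (Fin n → ℝ))
    (V : Opens (Fin n → ℝ)) : Opens X :=
  ⟨e.source ∩ e ⁻¹' V, e.isOpen_inter_preimage V.isOpen⟩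

lemma pre_mono {X : TopCat.{u}} {n : ℕ} (e : OpenPartialHomeomorph X (Fin n → ℝ))
    {V W : Opens (Fin n → ℝ)} (h : V ≤ W) : pre e V ≤ pre e W :=
  fun _ hx => ⟨hx.1, h hx.2⟩

/-- A chart of dimension `n|m` for a space with a sheaf of superalgebras (a sheaf of algebras `O`
with its parity involution `θ`): a homeomorphism of an open subset with an open subset of `ℝ^n`
and a compatible isomorphism of `O` with the sheaf `C^∞ ⊗ Λ(ξ^1, …, ξ^m)`. -/
structure SuperChart (n m : ℕ) (X : TopCat.{u}) (O : TopCat.Sheaf (AlgCat.{u} ℝ) X) (θ : O ⟶ O)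
    where
  toHomeo : OpenPartialHomeomorph X (Fin n → ℝ)
  iso : ∀ V : Opens (Fin n → ℝ), (V : Set (Fin n → ℝ)) ⊆ toHomeo.target →
    (O.presheaf.obj (.op (pre toHomeo V)) ≃ₐ[ℝ] BFun m V)
  iso_res : ∀ (V W : Opens (Fin n → ℝ)) (hV : (V : Set (Fin n → ℝ)) ⊆ toHomeo.target)
    (hW : (W : Set (Fin n → ℝ)) ⊆ toHomeo.target) (h : V ≤ W)
    (f : O.presheaf.obj (.op (pre toHomeo W))),
    iso V hV (sres O (pre_mono toHomeo h) f) = SFun.res h (iso W hW f)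
  iso_invol : ∀ (V : Opens (Fin n → ℝ)) (hV : (V : Set (Fin n → ℝ)) ⊆ toHomeo.target)
    (f : O.presheaf.obj (.op (pre toHomeo V))),
    iso V hV ((θ.hom.app (.op (pre toHomeo V))).hom f) = SFun.invol (iso V hV f)

/-- A smooth supermanifold of dimension `n|m`: a second countable Hausdorff space with a sheaf of
superalgebras that is locally isomorphic to `C^∞ ⊗ Λ(ξ^1, …, ξ^m)` over `ℝ^n`. Ordinary
manifolds are the case `m = 0`. -/
structure Supermanifold (n m : ℕ) where
  carrier : TopCat.{u}
  t2 : T2Space carrier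
  secondCountable : SecondCountableTopology carrier
  sheaf : TopCat.Sheaf (AlgCat.{u} ℝ) carrier
  invol : sheaf ⟶ sheaf
  exists_chart : ∀ x : carrier, ∃ c : SuperChart n m carrier sheaf invol, x ∈ c.toHomeo.source

namespace Supermanifold

variable {n m : ℕ} (M : Supermanifold.{u} n m)

/-- All local coordinate systems of `M`. -/
abbrev Chart : Type u := SuperChart n m M.carrier M.sheaf M.invol

variable {M}

/-- The range of a coordinate system. -/
def Chart.dom (c : M.Chart) : Opens (Fin n → ℝ) := ⟨c.toHomeo.target, c.toHomeo.open_target⟩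

/-- The change of coordinates from `c` to `c'` as a pull-back of functions, for open subsets `V`,
`V'` of the ranges such that the part of `M` over `V` lies in the part of `M` over `V'`. -/
def Chart.change (c c' : M.Chart) {V V' : Opens (Fin n → ℝ)} (hV : V ≤ c.dom) (hV' : V' ≤ c'.dom)
    (h : pre c.toHomeo V ≤ pre c'.toHomeo V') : BFun m V' →ₐ[ℝ] BFun m V :=
  ((c.iso V hV : _ →ₐ[ℝ] BFun m V).comp (sres M.sheaf h)).comp
    ((c'.iso V' hV').symm : BFun m V' →ₐ[ℝ] _)

variable (M)

/-- A system of functions `s(x,x*)`, one for every local coordinate system of `M`. -/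
abbrev LocalExpr : Type u := ∀ c : M.Chart, CFun m c.dom

/-- The local expressions `H(x,x*)` define a multivector field on `M`, that is, a function on
`ΠT*M`: on overlaps `H(x,x*) = H'(x',x*')`. -/
def IsMultivectorField (H : M.LocalExpr) : Prop :=
  ∀ (c c' : M.Chart) (V V' : Opens (Fin n → ℝ)) (hV : V ≤ c.dom) (hV' : V' ≤ c'.dom)
    (h : pre c.toHomeo V ≤ pre c'.toHomeo V'),
    ∃ Φ : CFun m V' →ₐ[ℝ] CFun m V, IsCotangentLift (c.change c' hV hV' h) Φ ∧
      SFun.res (cot_mono hV) (H c) = Φ (SFun.res (cot_mono hV') (H c'))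

/-- The local expressions `s(x,x*)` define a multivector density `s(x,x*) Dx` on `M`: on overlaps
`s(x,x*) = s'(x',x*') Ber(∂x'/∂x)`. -/
def IsMultivectorDensity (s : M.LocalExpr) : Prop :=
  ∀ (c c' : M.Chart) (V V' : Opens (Fin n → ℝ)) (hV : V ≤ c.dom) (hV' : V' ≤ c'.dom)
    (h : pre c.toHomeo V ≤ pre c'.toHomeo V'),
    ∃ Φ : CFun m V' →ₐ[ℝ] CFun m V, IsCotangentLift (c.change c' hV hV' h) Φ ∧
      SFun.res (cot_mono hV) (s c) = Φ (SFun.res (cot_mono hV') (s c')) *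
        baseHom V (ber (Matrix.of fun a b : Idx n m =>
          SFun.pd a (c.change c' hV hV' h (SFun.coord V' b))))

/-- The multivector field is homogeneous of parity `r`. -/
def HasParity (r : ZMod 2) (H : M.LocalExpr) : Prop := ∀ c, SFun.HasParity r (H c)

/-- The divergence operator `δ` on multivector densities. -/
def div (s : M.LocalExpr) : M.LocalExpr := fun c => divLocal (s c)

/-- The Lie derivative of multivector densities with respect to the infinitesimal canonical
transformation of `ΠT*M` generated by the Hamiltonian `H` of parity `h`. -/
def lie (h : ZMod 2) (H : M.LocalExpr) (s : M.LocalExpr) : M.LocalExpr :=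
  fun c => lieLocal h (H c) (s c)

end Supermanifold

end SuperGeom

end

noncomputable section

namespace SuperGeom

/-! ### Determinants and Berezinians over a square-zero extension -/

section TrivSqZero

variable {R M : Type} [Ring R] [AddCommGroup M] [Module R M] [Module Rᵐᵒᵖ M]

/-! Both claims are computations to first order in `ε`, carried out in each chart. At `ε = 0` the
transformation is the identity, so each Jacobi matrix is `1 + εK` and its Berezinian is `1 + ε str
K` (`ber_tsze`). Every diagonal entry of `K` is `∂²H/∂x^a∂x*_a` in the `x^a` slot and minus that in
the `x*_a` slot. Since `x*_a` has the parity opposite to `x^a`, the supertrace turns that minus sign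
back: positions and momenta contribute `δH` each. Hence `Ber ∂y/∂x = 1 + εδH`, and the full
Berezinian is `1 + 2εδH`, its square. For the Lie derivative, the `ε`-coefficient of `(s + ε{H,s})(1
+ εδH)` is `{H,s} + δH · s`: moving `ε` to the left past `s` costs a sign that is undone by moving
`δH`, which has the same parity, past `s` (`signHom_mul_of_hasParity`). As `δ` is of second order,
two Leibniz expansions of `δ(Hs)` produce exactly these terms and `(-1)^h H δs` (`divLocal_mul`). -/

lemma tsze_mul_eq_zero {x y : TrivSqZeroExt R M} (hx : x.fst = 0) (hy : y.fst = 0) :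
    x * y = 0 := by
  ext
  · simp [hx]
  · simp [hx, hy]

lemma tsze_list_prod_of_fst_eq_one (l : List (TrivSqZeroExt R M)) (hl : ∀ x ∈ l, x.fst = 1) :
    l.prod.fst = 1 ∧ l.prod.snd = (l.map TrivSqZeroExt.snd).sum := by
  induction l with
  | nil => simp
  | cons x l ih =>
    obtain ⟨h1, h2⟩ := ih fun y hy => hl y (List.mem_cons_of_mem _ hy)
    have hx := hl x List.mem_cons_self
    constructor
    · simp only [List.prod_cons, TrivSqZeroExt.fst_mul, hx, h1, one_mul]
    · simp only [List.prod_cons, TrivSqZeroExt.snd_mul, hx, h1, h2, one_smul, MulOpposite.op_one,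
        List.map_cons, List.sum_cons, add_comm]

variable [SMulCommClass R Rᵐᵒᵖ M]

open Classical in
-- Two factors from the square-zero ideal annihilate the product wherever they stand, so no
-- commutativity of the factors is needed.
lemma tsze_list_prod_eq_zero (l : List (TrivSqZeroExt R M))
    (hl : 2 ≤ l.countP (fun x => decide (x.fst = 0))) : l.prod = 0 := by
  induction l with
  | nil => simp at hl
  | cons x l ih =>
    rw [List.prod_cons]
    by_cases hx : x.fst = 0
    · rw [List.countP_cons_of_pos (by simpa using hx)] at hl
      have hl' := Nat.le_of_succ_le_succ hl
      obtain ⟨y, hy, hy0⟩ := List.countP_pos_iff.1 hl'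
      refine tsze_mul_eq_zero hx ?_
      rw [TrivSqZeroExt.fst_list_prod]
      exact List.prod_eq_zero (List.mem_map.2 ⟨y, hy, by simpa using hy0⟩)
    · rw [List.countP_cons_of_neg (by simpa using hx)] at hl
      rw [ih hl, mul_zero]

/-- A permutation other than the identity moves at least two indices, so its term contains two
off-diagonal factors, both multiples of `ε`. Only the diagonal product survives. -/
lemma detL_tsze {ι : Type} [Fintype ι] [DecidableEq ι] (A : Matrix ι ι (TrivSqZeroExt R M))
    (hA : ∀ i j, (A i j).fst = (1 : Matrix ι ι R) i j) :
    (detL A).fst = 1 ∧ (detL A).snd = ∑ i, (A i i).snd := by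
  have h : detL A = ((Finset.univ.toList : List ι).map fun i => A i i).prod := by
    rw [detL, Finset.sum_eq_single 1]
    · simp
    · intro s _ hs
      obtain ⟨i, hi⟩ : ∃ i, s i ≠ i := by
        by_contra! hc
        exact hs (Equiv.ext hc)
      rw [tsze_list_prod_eq_zero, smul_zero]
      rw [List.countP_map]
      -- The two moved indices are `i` and `s i`; they occur in the enumeration of the index set in
      -- some order.
      have hsub : [i, s i].Subperm (Finset.univ.toList : List ι) :=
        List.Nodup.subperm (by simpa using hi.symm) (fun x _ => by simp)
      refine le_trans ?_ (hsub.countP_le _)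
      have hi' : s (s i) ≠ s i := fun h => hi (s.injective h)
      simp [hA, hi, hi']
    · simp
  have := tsze_list_prod_of_fst_eq_one ((Finset.univ.toList : List ι).map fun i => A i i)
    (by simp [hA])
  rw [h]
  refine ⟨this.1, this.2.trans ?_⟩
  rw [List.map_map]
  exact Finset.sum_map_toList _ _

lemma ringInverse_tsze {x : TrivSqZeroExt R M} (hx : x.fst = 1) :
    (Ring.inverse x).fst = 1 ∧ (Ring.inverse x).snd = -x.snd := by
  set y : TrivSqZeroExt R M := TrivSqZeroExt.inl 1 - TrivSqZeroExt.inr x.snd with hy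
  have hxy : x * y = 1 := by ext <;> simp [hy, hx]
  have hyx : y * x = 1 := by ext <;> simp [hy, hx]
  have : Ring.inverse x = y := Ring.inverse_unit (⟨x, y, hxy, hyx⟩ : (TrivSqZeroExt R M)ˣ)
  rw [this]
  simp [hy]

/-- The Berezinian of `1 + ε K` is `1 + ε str K`. -/
lemma ber_tsze {p q : Type} [Fintype p] [Fintype q] [DecidableEq p] [DecidableEq q]
    (J : Matrix (p ⊕ q) (p ⊕ q) (TrivSqZeroExt R M))
    (hJ : ∀ i j, (J i j).fst = (1 : Matrix (p ⊕ q) (p ⊕ q) R) i j) :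
    (ber J).fst = 1 ∧
      (ber J).snd = ∑ i, (J (.inl i) (.inl i)).snd - ∑ j, (J (.inr j) (.inr j)).snd := by
  -- Both off-diagonal blocks are multiples of `ε`, so the Schur correction vanishes whatever value
  -- `Ring.inverse` takes.
  have h0 : J.toBlocks₁₂ * Ring.inverse J.toBlocks₂₂ * J.toBlocks₂₁ = 0 := by
    ext1 i j
    rw [Matrix.mul_apply]
    refine Finset.sum_eq_zero fun k _ => tsze_mul_eq_zero ?_ ?_
    · rw [Matrix.mul_apply, TrivSqZeroExt.fst_sum]
      refine Finset.sum_eq_zero fun l _ => ?_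
      simp [Matrix.toBlocks₁₂, hJ]
    · simp [Matrix.toBlocks₂₁, hJ]
  obtain ⟨h1, h2⟩ := detL_tsze J.toBlocks₁₁
    (fun i j => by simp [Matrix.toBlocks₁₁, hJ, Matrix.one_apply])
  obtain ⟨h3, h4⟩ := detL_tsze J.toBlocks₂₂
    (fun i j => by simp [Matrix.toBlocks₂₂, hJ, Matrix.one_apply])
  obtain ⟨h5, h6⟩ := ringInverse_tsze h3
  rw [ber, h0, sub_zero]
  refine ⟨by simp [h1, h5], ?_⟩
  rw [TrivSqZeroExt.snd_mul, h1, h5, h2, h6, h4]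
  simp [Matrix.toBlocks₁₁, Matrix.toBlocks₂₂]
  abel

end TrivSqZero

/-! ### Signs -/

lemma sgn_zero : sgn 0 = 1 := by simp [sgn]

lemma sgn_one : sgn 1 = -1 := by simp [sgn, ZMod.val_one]

lemma zmod_two_cases (a : ZMod 2) : a = 0 ∨ a = 1 := by
  revert a; decide

lemma sgn_add (a b : ZMod 2) : sgn (a + b) = sgn a * sgn b := by
  rcases zmod_two_cases a with rfl | rfl <;> rcases zmod_two_cases b with rfl | rfl <;>
    simp [sgn_zero, sgn_one, show (1 + 1 : ZMod 2) = 0 from rfl]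

lemma sgn_mul_self (a : ZMod 2) : sgn a * sgn a = 1 := by
  rcases zmod_two_cases a with rfl | rfl <;> simp [sgn_zero, sgn_one]

/-! ### The Grassmann algebra -/

namespace Grassmann

open CliffordAlgebra

variable {q : Type}

/-- Generators anticommute, so moving one past `x` produces the sign of each homogeneous part of
`x`. -/
lemma ι_mul (v : q → ℝ) (x : Grassmann q) :
    ExteriorAlgebra.ι ℝ v * x = involute x * ExteriorAlgebra.ι ℝ v := by
  induction x using CliffordAlgebra.left_induction with
  | algebraMap r => rw [AlgHom.commutes]; exact (Algebra.commutes r _).symm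
  | add x y hx hy => rw [map_add, mul_add, add_mul, hx, hy]
  | ι_mul x w hx =>
    have h : ExteriorAlgebra.ι ℝ v * ExteriorAlgebra.ι ℝ w =
        -(ExteriorAlgebra.ι ℝ w * ExteriorAlgebra.ι ℝ v) :=
      eq_neg_of_add_eq_zero_left (ExteriorAlgebra.ι_add_mul_swap v w)
    rw [map_mul, involute_ι, ← mul_assoc]
    change ExteriorAlgebra.ι ℝ v * ExteriorAlgebra.ι ℝ w * x =
      -ExteriorAlgebra.ι ℝ w * involute x * ExteriorAlgebra.ι ℝ v
    rw [h, neg_mul, neg_mul, neg_mul, mul_assoc, hx, mul_assoc]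

/-- Even elements are central, and odd elements commute up to the parity involution. -/
lemma supercomm (x : Grassmann q) : ∀ s : Grassmann q,
    s * (x + involute x) = (x + involute x) * s ∧
      involute s * (x - involute x) = (x - involute x) * s := by
  induction x using CliffordAlgebra.left_induction with
  | algebraMap r =>
    intro s
    rw [AlgHom.commutes, sub_self, mul_zero, zero_mul, mul_add, add_mul]
    exact ⟨by rw [(Algebra.commutes r s : _)], rfl⟩
  | add x y hx hy =>
    intro s
    have h1 : x + y + involute (x + y) = (x + involute x) + (y + involute y) := by
      rw [map_add]; abel
    have h2 : x + y - involute (x + y) = (x - involute x) + (y - involute y) := by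
      rw [map_add]; abel
    constructor
    · rw [h1, mul_add s, add_mul _ _ s, (hx s).1, (hy s).1]
    · rw [h2, mul_add, add_mul _ _ s, (hx s).2, (hy s).2]
  | ι_mul x w hx =>
    intro s
    -- The elements `x ± involute x` are twice the even and odd parts. Multiplying by a generator
    -- exchanges them, so the two statements need a joint induction, uniform in `s`.
    have h1 : CliffordAlgebra.ι (0 : QuadraticForm ℝ (q → ℝ)) w * x +
        involute (CliffordAlgebra.ι (0 : QuadraticForm ℝ (q → ℝ)) w * x) =
        ExteriorAlgebra.ι ℝ w * (x - involute x) := by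
      rw [map_mul, involute_ι, neg_mul, mul_sub, sub_eq_add_neg]
    have h2 : CliffordAlgebra.ι (0 : QuadraticForm ℝ (q → ℝ)) w * x -
        involute (CliffordAlgebra.ι (0 : QuadraticForm ℝ (q → ℝ)) w * x) =
        ExteriorAlgebra.ι ℝ w * (x + involute x) := by
      rw [map_mul, involute_ι, neg_mul, mul_add, sub_neg_eq_add]
    have h3 : s * ExteriorAlgebra.ι ℝ w = ExteriorAlgebra.ι ℝ w * involute s := by
      rw [ι_mul, involute_involute]
    rw [h1, h2]
    constructor
    · rw [← mul_assoc, h3, mul_assoc, (hx s).2, mul_assoc]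
    · rw [← mul_assoc, ← ι_mul, mul_assoc, (hx s).1, mul_assoc]

lemma contractLeft_mul (d : Module.Dual ℝ (q → ℝ)) (x y : Grassmann q) :
    contractLeft d (x * y) = contractLeft d x * y + involute x * contractLeft d y := by
  induction x using CliffordAlgebra.left_induction with
  | algebraMap r =>
    rw [contractLeft_algebraMap_mul, contractLeft_algebraMap, zero_mul, zero_add, AlgHom.commutes]
  | add a b ha hb =>
    rw [add_mul, map_add, ha, hb, map_add, map_add, add_mul, add_mul]; abel
  | ι_mul a v ha =>
    rw [mul_assoc, contractLeft_ι_mul, ha, contractLeft_ι_mul, map_mul, involute_ι]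
    simp only [sub_mul, mul_add, smul_mul_assoc, neg_mul, mul_assoc]
    abel

/-- Contraction lowers the degree by one, hence reverses parity. -/
lemma contractLeft_involute (d : Module.Dual ℝ (q → ℝ)) (x : Grassmann q) :
    contractLeft d (involute x) = -involute (contractLeft d x) := by
  induction x using CliffordAlgebra.left_induction with
  | algebraMap r => rw [AlgHom.commutes, contractLeft_algebraMap, map_zero, neg_zero]
  | add a b ha hb => rw [map_add, map_add, ha, hb, map_add, map_add, neg_add]
  | ι_mul a v ha =>
    rw [map_mul, involute_ι, neg_mul, map_neg, contractLeft_ι_mul, contractLeft_ι_mul, ha,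
      map_sub, map_mul, involute_ι, map_smul]
    simp

end Grassmann

/-! ### Partial derivatives of smooth functions -/

namespace Smooth

variable {p : Type} [Fintype p] [DecidableEq p] {W : Opens (p → ℝ)}

lemma pd_mul (i : p) (f g : Smooth W) : pd i (f * g) = pd i f * g + f * pd i g := by
  ext w
  have hd := fun h : Smooth W => (contDiffAt_extend h w).differentiableAt (by simp)
  have hv := fun h : Smooth W => Subtype.val_injective.extend_apply (h : W → ℝ) 0 w
  have he : Function.extend Subtype.val (fun x : W => f x * g x) (0 : (p → ℝ) → ℝ) =
      Function.extend Subtype.val (f : W → ℝ) 0 *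
        Function.extend Subtype.val (g : W → ℝ) 0 := by
    have := Function.extend_mul (Subtype.val : W → (p → ℝ)) (f : W → ℝ) (g : W → ℝ) 0 0
    rw [mul_zero] at this
    exact this
  have := congrArg (fun k : (p → ℝ) → ℝ => fderiv ℝ k (w : p → ℝ) (Pi.single i 1)) he
  simp only [fderiv_mul (hd f) (hd g), hv, add_apply, smul_apply, smul_eq_mul] at this
  refine this.trans ?_
  rw [add_comm, mul_comm (g w)]
  rfl

lemma pd_one (i : p) : pd i (1 : Smooth W) = 0 := by
  have := pd_mul i (1 : Smooth W) 1
  simpa using this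

lemma pd_coord (i j : p) : pd i (coord W j) = if i = j then 1 else 0 := by
  ext w
  -- The zero extension agrees with the linear projection only on `W`; a germ at `w` is enough for
  -- the derivative.
  have he : Function.extend Subtype.val (coord W j : W → ℝ) (0 : (p → ℝ) → ℝ) =ᶠ[nhds (w : p → ℝ)]
      ContinuousLinearMap.proj (R := ℝ) (φ := fun _ : p => ℝ) j := by
    filter_upwards [W.isOpen.mem_nhds w.2] with x hx
    exact Subtype.val_injective.extend_apply (coord W j : W → ℝ) 0 (⟨x, hx⟩ : W)
  have : pd i (coord W j) w = (Pi.single i 1 : p → ℝ) j :=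
    (congrArg (fun k : (p → ℝ) →L[ℝ] ℝ => k (Pi.single i 1))
      (he.fderiv_eq.trans (ContinuousLinearMap.fderiv _)))
  rw [this, Pi.single_apply]
  split_ifs with h1 h2 h2
  · rfl
  · exact absurd h1.symm h2
  · exact absurd h2.symm h1
  · rfl

end Smooth

/-! ### Functions on superdomains: supercommutativity and the Leibniz rule -/

namespace SFun

variable {p q : Type} [Fintype p] {W : Opens (p → ℝ)}

lemma sgn_one_smul (f : SFun W q) : sgn 1 • f = -f := by
  refine eq_neg_of_add_eq_zero_left ?_
  rw [sgn_one, ← one_smul ℝ f, smul_smul, ← add_smul]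
  norm_num

lemma invol_tmul (f : Smooth W) (x : Grassmann q) :
    invol (f ⊗ₜ[ℝ] x : SFun W q) = f ⊗ₜ[ℝ] CliffordAlgebra.involute x := rfl

/-- Smooth coefficients commute and carry no parity, so on pure tensors this is
`Grassmann.supercomm`. -/
lemma supercomm (g s : SFun W q) :
    s * (g + invol g) = (g + invol g) * s ∧ invol s * (g - invol g) = (g - invol g) * s := by
  induction g using TensorProduct.induction_on with
  | zero => simp
  | add a b ha hb =>
    have h1 : a + b + invol (a + b) = (a + invol a) + (b + invol b) := by
      rw [map_add]; abel
    have h2 : a + b - invol (a + b) = (a - invol a) + (b - invol b) := by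
      rw [map_add]; abel
    constructor
    · rw [h1, mul_add s, add_mul _ _ s, ha.1, hb.1]
    · rw [h2, mul_add, add_mul _ _ s, ha.2, hb.2]
  | tmul f x =>
    induction s using TensorProduct.induction_on with
    | zero => simp
    | add a b ha hb =>
      constructor
      · rw [add_mul a b, mul_add _ a b, ha.1, hb.1]
      · rw [map_add, add_mul, mul_add _ a b, ha.2, hb.2]
    | tmul k y =>
      rw [invol_tmul, invol_tmul, ← TensorProduct.tmul_add, ← TensorProduct.tmul_sub,
        Algebra.TensorProduct.tmul_mul_tmul, Algebra.TensorProduct.tmul_mul_tmul,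
        Algebra.TensorProduct.tmul_mul_tmul, Algebra.TensorProduct.tmul_mul_tmul,
        (Grassmann.supercomm x y).1, (Grassmann.supercomm x y).2, mul_comm k f]
      exact ⟨rfl, rfl⟩

lemma signHom_zero (f : SFun W q) : signHom 0 f = f := by simp [signHom]

lemma signHom_one (f : SFun W q) : signHom 1 f = invol f := by simp [signHom]

lemma signHom_of_hasParity {h : ZMod 2} {f : SFun W q} (hf : HasParity h f) (r : ZMod 2) :
    signHom r f = sgn (r * h) • f := by
  rcases zmod_two_cases r with rfl | rfl
  · rw [signHom_zero, zero_mul, sgn_zero, one_smul]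
  · rw [signHom_one, one_mul]; exact hf

/-- A function of parity `r` supercommutes with all functions. -/
lemma signHom_mul_of_hasParity {r : ZMod 2} {g : SFun W q} (hg : HasParity r g) (s : SFun W q) :
    signHom r s * g = g * s := by
  -- For homogeneous `g`, one of `g ± invol g` is `2g`; this allows division by two in `supercomm`.
  have h2 : ∀ x : SFun W q, x = (2⁻¹ : ℝ) • (x + x) := fun x => by
    rw [← two_smul ℝ x, smul_smul]; norm_num
  rcases zmod_two_cases r with rfl | rfl
  · have hi : invol g = g := by rw [hg, sgn_zero, one_smul]
    have := (supercomm g s).1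
    rw [hi, mul_add, add_mul] at this
    rw [signHom_zero, h2 (s * g), this, ← h2]
  · have hi : invol g = -g := by rw [hg, sgn_one_smul]
    have := (supercomm g s).2
    rw [hi, sub_neg_eq_add, mul_add, add_mul] at this
    rw [signHom_one, h2 (invol s * g), this, ← h2]

lemma HasParity.smul {r : ZMod 2} {f : SFun W q} (hf : HasParity r f) (c : ℝ) :
    HasParity r (c • f) := by
  rw [HasParity, map_smul, hf, smul_comm]

lemma HasParity.sum {ι : Type} {r : ZMod 2} {t : Finset ι} {f : ι → SFun W q}
    (hf : ∀ i ∈ t, HasParity r (f i)) : HasParity r (∑ i ∈ t, f i) := by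
  rw [HasParity, map_sum, Finset.smul_sum]
  exact Finset.sum_congr rfl hf

variable [DecidableEq p]

lemma pd_inl_tmul (i : p) (f : Smooth W) (x : Grassmann q) :
    pd (.inl i) (f ⊗ₜ[ℝ] x : SFun W q) = Smooth.pd i f ⊗ₜ[ℝ] x := rfl

lemma pd_inr_tmul (j : q) (f : Smooth W) (x : Grassmann q) :
    pd (.inr j) (f ⊗ₜ[ℝ] x : SFun W q) =
      f ⊗ₜ[ℝ] CliffordAlgebra.contractLeft (LinearMap.proj j : (q → ℝ) →ₗ[ℝ] ℝ) x := rfl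

/-- Writing the sign `(-1)^{Ã f̃}` as `signHom (par A) f` makes the rule valid for inhomogeneous
`f`. -/
lemma pd_mul (A : p ⊕ q) (f g : SFun W q) :
    pd A (f * g) = pd A f * g + signHom (par A) f * pd A g := by
  induction f using TensorProduct.induction_on with
  | zero => simp
  | add a b ha hb => rw [add_mul, map_add, map_add, map_add, ha, hb, add_mul, add_mul]; abel
  | tmul f x =>
    induction g using TensorProduct.induction_on with
    | zero => simp
    | add a b ha hb => rw [mul_add, map_add, map_add, ha, hb, mul_add, mul_add]; abel
    | tmul g y =>
      rw [Algebra.TensorProduct.tmul_mul_tmul]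
      rcases A with i | j
      · rw [pd_inl_tmul, pd_inl_tmul, pd_inl_tmul, Smooth.pd_mul]
        change _ = _ + signHom 0 _ * _
        rw [signHom_zero, Algebra.TensorProduct.tmul_mul_tmul, Algebra.TensorProduct.tmul_mul_tmul,
          TensorProduct.add_tmul]
      · rw [pd_inr_tmul, pd_inr_tmul, pd_inr_tmul]
        change _ = _ + signHom 1 _ * _
        rw [signHom_one, invol_tmul, Algebra.TensorProduct.tmul_mul_tmul,
          Algebra.TensorProduct.tmul_mul_tmul, ← TensorProduct.tmul_add]
        congr 1
        exact Grassmann.contractLeft_mul _ _ _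

lemma pd_invol (A : p ⊕ q) (f : SFun W q) : pd A (invol f) = sgn (par A) • invol (pd A f) := by
  induction f using TensorProduct.induction_on with
  | zero => simp
  | add a b ha hb => rw [map_add, map_add, ha, hb, map_add, map_add, smul_add]
  | tmul f x =>
    rcases A with i | j
    · change _ = sgn 0 • _
      rw [sgn_zero, one_smul, invol_tmul, pd_inl_tmul, pd_inl_tmul, invol_tmul]
    · change _ = sgn 1 • _
      rw [sgn_one_smul, invol_tmul, pd_inr_tmul, pd_inr_tmul, invol_tmul,
        ← TensorProduct.tmul_neg]
      congr 1
      exact Grassmann.contractLeft_involute _ _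

lemma HasParity.pd {r : ZMod 2} {f : SFun W q} (hf : HasParity r f) (A : p ⊕ q) :
    HasParity (r + par A) (SFun.pd A f) := by
  have := pd_invol A f
  rw [hf, map_smul] at this
  rw [HasParity, sgn_add, mul_comm, mul_smul, this, smul_smul, sgn_mul_self, one_smul]

/-- Derivatives along an even and an odd coordinate commute. -/
lemma pd_comm_even_odd (i : p) (j : q) (f : SFun W q) :
    pd (.inl i) (pd (.inr j) f) = pd (.inr j) (pd (.inl i) f) := by
  induction f using TensorProduct.induction_on with
  | zero => simp
  | add a b ha hb => simp only [map_add, ha, hb]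
  | tmul f x => rfl

lemma pd_coord [DecidableEq q] (A B : p ⊕ q) :
    pd A (coord W B : SFun W q) = if A = B then 1 else 0 := by
  rcases A with i | i <;> rcases B with j | j
  · change pd (.inl i) (Smooth.coord W j ⊗ₜ[ℝ] (1 : Grassmann q)) = _
    rw [pd_inl_tmul, Smooth.pd_coord]
    simp only [Sum.inl.injEq]
    split_ifs
    · rfl
    · exact TensorProduct.zero_tmul _ _
  · change pd (.inl i) ((1 : Smooth W) ⊗ₜ[ℝ] _) = _
    rw [pd_inl_tmul, Smooth.pd_one, TensorProduct.zero_tmul]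
    simp
  · change pd (.inr i) (Smooth.coord W j ⊗ₜ[ℝ] (1 : Grassmann q)) = _
    rw [pd_inr_tmul, CliffordAlgebra.contractLeft_one, TensorProduct.tmul_zero]
    simp
  · change pd (.inr i) ((1 : Smooth W) ⊗ₜ[ℝ] ExteriorAlgebra.ι ℝ (Pi.single j (1 : ℝ))) = _
    rw [pd_inr_tmul]
    have : CliffordAlgebra.contractLeft (LinearMap.proj i : (q → ℝ) →ₗ[ℝ] ℝ)
        (ExteriorAlgebra.ι ℝ (Pi.single j (1 : ℝ))) =
        algebraMap ℝ (Grassmann q) ((Pi.single j (1 : ℝ) : q → ℝ) i) :=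
      CliffordAlgebra.contractLeft_ι _ _ _
    rw [this, Pi.single_apply]
    simp only [Sum.inr.injEq]
    split_ifs
    · rw [map_one]; rfl
    · rw [map_zero, TensorProduct.tmul_zero]

end SFun

/-! ### Infinitesimal canonical transformations in coordinates -/

section Local

variable {n m : ℕ} {V : Opens (Fin n → ℝ)}

lemma par_pos (a : Idx n m) : par (pos a) = par a := by
  rcases a with i | j <;> rfl

lemma par_mom (a : Idx n m) : par (mom a) = par a + 1 := by
  rcases a with i | j <;> rfl

lemma pos_injective : Function.Injective (pos : Idx n m → CIdx n m) :=
  Sum.map_injective.2 ⟨Sum.inl_injective, Sum.inl_injective⟩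

lemma mom_inj {a b : Idx n m} : mom a = mom b ↔ a = b := by
  rcases a with i | i <;> rcases b with j | j <;> simp [mom]

lemma mom_ne_pos (a b : Idx n m) : mom a ≠ pos b := by
  rcases a with i | i <;> rcases b with j | j <;> simp [mom, pos]

/-- `∂/∂x^a` and `∂/∂x*_a` commute, being of opposite parity. -/
lemma pd_mom_pd_pos (a : Idx n m) (f : CFun m V) :
    SFun.pd (mom a) (SFun.pd (pos a) f) = SFun.pd (pos a) (SFun.pd (mom a) f) := by
  rcases a with i | j
  · exact (SFun.pd_comm_even_odd _ _ f).symm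
  · exact SFun.pd_comm_even_odd _ _ f

lemma divLocal_apply (f : CFun m V) :
    divLocal f = ∑ a : Idx n m, sgn (par a) • SFun.pd (pos a) (SFun.pd (mom a) f) := by
  simp [divLocal, LinearMap.sum_apply]

/-! ### Hamilton's equations and the Jacobi matrix -/

lemma oddBracket_coord_pos (h : ZMod 2) (H : CFun m V) (b : Idx n m) :
    oddBracket h H (SFun.coord _ (pos b)) =
      (sgn (par b) * sgn (par b * h)) • SFun.pd (mom b) H := by
  rw [oddBracket, Finset.sum_eq_single b]
  · rw [SFun.pd_coord, SFun.pd_coord, if_pos rfl, if_neg (mom_ne_pos _ _), mul_one, mul_zero,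
      smul_zero, add_zero, smul_smul]
  · intro a _ hab
    rw [SFun.pd_coord, SFun.pd_coord, if_neg (pos_injective.ne hab), if_neg (mom_ne_pos _ _),
      mul_zero, mul_zero, smul_zero, smul_zero, add_zero, smul_zero]
  · simp

lemma oddBracket_coord_mom (h : ZMod 2) (H : CFun m V) (b : Idx n m) :
    oddBracket h H (SFun.coord _ (mom b)) =
      (sgn (par b) * sgn ((par b + 1) * h)) • SFun.pd (pos b) H := by
  rw [oddBracket, Finset.sum_eq_single b]
  · rw [SFun.pd_coord, SFun.pd_coord, if_pos rfl, if_neg (mom_ne_pos _ _).symm, mul_one, mul_zero,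
      smul_zero, zero_add, smul_smul]
  · intro a _ hab
    rw [SFun.pd_coord, SFun.pd_coord, if_neg (mom_inj.not.2 hab), if_neg (mom_ne_pos _ _).symm,
      mul_zero, mul_zero, smul_zero, smul_zero, add_zero, smul_zero]
  · simp

lemma jacobian_hamTransf_fst (h : ZMod 2) (H : CFun m V) (A B : CIdx n m) :
    (jacobian (hamTransf h H) A B).fst = (1 : Matrix (CIdx n m) (CIdx n m) (CFun m V)) A B := by
  rw [Matrix.one_apply]
  exact SFun.pd_coord A B

lemma jacobian_hamTransf_snd (h : ZMod 2) (H : CFun m V) (A B : CIdx n m) :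
    EpsFun.epsCoeff (jacobian (hamTransf h H) A B) =
      sgn (par A * (h + 1)) • SFun.pd A (oddBracket h H (SFun.coord _ B)) := rfl

lemma jacobian_hamTransf_pos (h : ZMod 2) (H : CFun m V) (a : Idx n m) :
    EpsFun.epsCoeff (jacobian (hamTransf h H) (pos a) (pos a)) =
      SFun.pd (pos a) (SFun.pd (mom a) H) := by
  rw [jacobian_hamTransf_snd, oddBracket_coord_pos, map_smul, smul_smul, par_pos, ← sgn_add,
    ← sgn_add]
  -- The first summand comes from moving `∂_a` past `ε`, the rest from the bracket.
  have : par a * (h + 1) + (par a + par a * h) = 0 := by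
    generalize par a = r
    revert r h; decide
  rw [this, sgn_zero, one_smul]

/-- The sign exponents now add up to an odd number. This minus sign offsets the opposite parity of
`x*_a` in the supertrace. -/
lemma jacobian_hamTransf_mom (h : ZMod 2) (H : CFun m V) (a : Idx n m) :
    EpsFun.epsCoeff (jacobian (hamTransf h H) (mom a) (mom a)) =
      -SFun.pd (pos a) (SFun.pd (mom a) H) := by
  rw [jacobian_hamTransf_snd, oddBracket_coord_mom, map_smul, smul_smul, par_mom, ← sgn_add,
    ← sgn_add]
  have : (par a + 1) * (h + 1) + (par a + (par a + 1) * h) = 1 := by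
    generalize par a = r
    revert r h; decide
  rw [this, SFun.sgn_one_smul, pd_mom_pd_pos]

/-- `Ber ∂y/∂x = 1 + ε δH` for the infinitesimal canonical transformation generated by `H`. -/
lemma ber_jacobianPos_hamTransf (h : ZMod 2) (H : CFun m V) :
    ber (jacobianPos (hamTransf h H)) = EpsFun.mk 1 (divLocal H) := by
  obtain ⟨h1, h2⟩ := ber_tsze (jacobianPos (hamTransf h H)) (fun a b => by
    refine (jacobian_hamTransf_fst h H (pos a) (pos b)).trans ?_
    rw [Matrix.one_apply, Matrix.one_apply]
    exact if_congr pos_injective.eq_iff rfl rfl)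
  refine TrivSqZeroExt.ext h1 (h2.trans ?_)
  refine Eq.trans ?_ (divLocal_apply H).symm
  rw [Fintype.sum_sum_type, sub_eq_add_neg, ← Finset.sum_neg_distrib]
  refine congrArg₂ (· + ·) (Finset.sum_congr rfl fun i _ => ?_) (Finset.sum_congr rfl fun j _ => ?_)
  · refine (jacobian_hamTransf_pos h H (.inl i)).trans ?_
    change _ = sgn 0 • _
    rw [sgn_zero, one_smul]
  · refine (congrArg Neg.neg (jacobian_hamTransf_pos h H (.inr j))).trans ?_
    exact (SFun.sgn_one_smul _).symm

/-- `Ber ∂(y,y*)/∂(x,x*) = 1 + 2 ε δH` for the infinitesimal canonical transformation generated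
by `H`. -/
lemma ber_jacobian_hamTransf (h : ZMod 2) (H : CFun m V) :
    ber (jacobian (hamTransf h H)) = EpsFun.mk 1 (divLocal H + divLocal H) := by
  obtain ⟨h1, h2⟩ := ber_tsze (jacobian (hamTransf h H)) (jacobian_hamTransf_fst h H)
  refine TrivSqZeroExt.ext h1 (h2.trans ?_)
  have hp := jacobian_hamTransf_pos h H
  have hm := jacobian_hamTransf_mom h H
  have hd : divLocal H =
      ∑ i : Fin n, SFun.pd (pos (.inl i)) (SFun.pd (mom (.inl i)) H) -
        ∑ j : Fin m, SFun.pd (pos (.inr j)) (SFun.pd (mom (.inr j)) H) := by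
    rw [divLocal_apply, Fintype.sum_sum_type, sub_eq_add_neg, ← Finset.sum_neg_distrib]
    refine congrArg₂ (· + ·) (Finset.sum_congr rfl fun i _ => ?_)
      (Finset.sum_congr rfl fun j _ => SFun.sgn_one_smul _)
    change sgn 0 • _ = _
    rw [sgn_zero, one_smul]
  -- Here `f` and `g` hold the second derivatives for even and odd `a`. The even coordinates of
  -- `ΠT*M` are the even `x^a` and the `x*_a` with `a` odd; the odd coordinates are the remaining
  -- ones.
  have key : ∀ (f : Fin n → CFun m V) (g : Fin m → CFun m V),
      (∑ i, f i + ∑ j, -g j) - (∑ j, g j + ∑ i, -f i) =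
        (∑ i, f i - ∑ j, g j) + (∑ i, f i - ∑ j, g j) := fun f g => by
    rw [Finset.sum_neg_distrib, Finset.sum_neg_distrib]
    abel
  rw [Fintype.sum_sum_type, Fintype.sum_sum_type]
  refine Eq.trans (congrArg₂ (· - ·)
    (congrArg₂ (· + ·) (Finset.sum_congr rfl fun i _ => hp (.inl i))
      (Finset.sum_congr rfl fun j _ => hm (.inr j)))
    (congrArg₂ (· + ·) (Finset.sum_congr rfl fun j _ => hp (.inr j))
      (Finset.sum_congr rfl fun i _ => hm (.inl i)))) ?_
  exact (key _ _).trans (congrArg₂ (· + ·) hd hd).symm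

lemma ber_jacobianPos_hamTransf_sq (h : ZMod 2) (H : CFun m V) :
    ber (jacobianPos (hamTransf h H)) ^ 2 = ber (jacobian (hamTransf h H)) := by
  rw [ber_jacobianPos_hamTransf, ber_jacobian_hamTransf, sq]
  refine TrivSqZeroExt.ext (one_mul (1 : CFun m V)) ?_
  -- The left action on multiples of `ε` is twisted by `signHom`, which fixes `1`.
  change SFun.signHom (h + 1) (1 : CFun m V) * divLocal H + divLocal H * 1 = _
  rw [map_one, one_mul, mul_one]
  rfl

/-! ### The divergence of a product and the Lie derivative -/

/-- Each term differentiates once along `x^a` and once along `x*_a`, of opposite parities. That `δH`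
has the parity of `ε` is what lets it pass `s` in `lieLocal_eq`. -/
lemma divLocal_hasParity {h : ZMod 2} {H : CFun m V} (hH : SFun.HasParity h H) :
    SFun.HasParity (h + 1) (divLocal H) := by
  rw [divLocal_apply]
  refine SFun.HasParity.sum fun a _ => SFun.HasParity.smul ?_ _
  have := (hH.pd (mom a)).pd (pos a)
  rw [par_mom, par_pos] at this
  have he : h + (par a + 1) + par a = h + 1 := by
    generalize par a = r
    clear * -
    revert r h; decide
  rwa [he] at this

/-- The odd bracket measures the failure of the divergence to be a derivation. -/
lemma divLocal_mul {h : ZMod 2} {H : CFun m V} (hH : SFun.HasParity h H) (s : CFun m V) :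
    divLocal (H * s) = divLocal H * s + oddBracket h H s + sgn h • (H * divLocal s) := by
  simp only [divLocal_apply, oddBracket, Finset.sum_mul, Finset.mul_sum, Finset.smul_sum,
    ← Finset.sum_add_distrib]
  refine Finset.sum_congr rfl fun a _ => ?_
  have hm := hH.pd (mom a)
  rw [SFun.pd_mul, SFun.signHom_of_hasParity hH, map_add, SFun.pd_mul, smul_mul_assoc, map_smul,
    SFun.pd_mul, SFun.signHom_of_hasParity hH, SFun.signHom_of_hasParity hm, par_pos, par_mom,
    smul_mul_assoc, smul_mul_assoc, mul_smul_comm, smul_mul_assoc (sgn (par a)) _ s]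
  generalize SFun.pd (pos a) (SFun.pd (mom a) H) * s = X
  generalize SFun.pd (mom a) H * SFun.pd (pos a) s = Y
  generalize SFun.pd (pos a) H * SFun.pd (mom a) s = Z
  generalize H * SFun.pd (pos a) (SFun.pd (mom a) s) = U
  -- Signs of the cross term `Y` and of the last term `U`: the product `ã(ã+1)` is even, and moving
  -- both derivatives past `H` costs `(-1)^h` in total.
  have e1 : par a * (h + (par a + 1)) = par a * h := by
    generalize par a = r
    clear * -
    revert r h; decide
  have e2 : sgn ((par a + 1) * h) * sgn (par a * h) = sgn h := by
    rw [← sgn_add]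
    congr 1
    generalize par a = r
    clear * -
    revert r h; decide
  rw [e1, ← e2]
  module

lemma lieLocal_eq {h : ZMod 2} {H : CFun m V} (hH : SFun.HasParity h H) (s : CFun m V) :
    lieLocal h H s = divLocal (H * s) - sgn h • (H * divLocal s) := by
  rw [lieLocal, pullDensity, ber_jacobianPos_hamTransf]
  -- This is the `ε`-coefficient of `(s + ε{H,s})(1 + εδH)`; the twist on `s` comes from moving `ε`
  -- to the left.
  change SFun.signHom (h + 1) s * divLocal H + oddBracket h H s * 1 = _
  rw [SFun.signHom_mul_of_hasParity (divLocal_hasParity hH), mul_one, divLocal_mul hH,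
    add_sub_cancel_right]

end Local

end SuperGeom

end

theorem mainTheorem5 {n m : ℕ} (M : SuperGeom.Supermanifold.{u} n m) (h : ZMod 2)
    (H : M.LocalExpr) (hH : M.IsMultivectorField H) (hh : M.HasParity h H)
    (s : M.LocalExpr) (hs : M.IsMultivectorDensity s) :
    (∀ c : M.Chart,
      SuperGeom.ber (SuperGeom.jacobianPos (SuperGeom.hamTransf h (H c))) ^ 2 =
        SuperGeom.ber (SuperGeom.jacobian (SuperGeom.hamTransf h (H c)))) ∧
    M.lie h H s = M.div (H * s) - SuperGeom.sgn h • (H * M.div s) :=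
  ⟨fun c => SuperGeom.ber_jacobianPos_hamTransf_sq h (H c),
    funext fun c => SuperGeom.lieLocal_eq (hh c) (s c)⟩
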